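/- Let $E=(E^0,E^1,r_E,s_E)$ be a finite (non-empty) directed graph without sinks or sources, i.e. $r_E,s_E:E^1\to E^0$ are both surjective. Let $$X_E=\{(e_0,e_1,\dots)\in (E^1)^{\mathbb N} : s_E(e_i)=r_E(e_{i+1})\text{ for all } i\ge 0\},\qquad \sigma_E(e_0,e_1,e_2,\dots)=(e_1,e_2,\dots),$$ with the topology generated by the cylinder sets, be its one-sided shift of finite type. *The separated graph $(E',C')$.* It is bipartite, with vertex layers $\{v^i\}_{i\in E^0}$ and $\{v_i\}_{i\in E^0}$ (two disjoint copies of $E^0$); its edges are one blue edge $e_i$ with $s(e_i)=v_i$, $r(e_i)=v^i$ for each $i\in E^0$, and one red edge $\bar f$ with $s(\bar f)=v_{s_E(f)}$, $r(\bar f)=v^{r_E(f)}$ for each $f\in E^1$. The set of edges with range $v^i$ is partitioned as $C'_{v^i}=\{B_i,R_i\}$, with $B_i=\{e_i\}$ and $R_i=\{\bar f: r_E(f)=i\}$. *Canonical resolution.* Given a finite bipartite separated graph $(G,C)$ (edges go from $G^{0,1}$ onto $G^{0,0}$, and $C_u$ is a partition of $r^{-1}(u)$ into non-empty sets $X^u_1,\dots,X^u_{k_u}$,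 for $u\in G^{0,0}$), its $1$-step resolution $(G_1,C^1)$ has $G_1^{0,0}=G^{0,1}$, $G_1^{0,1}=\{v(x_1,\dots,x_{k_u}) : u\in G^{0,0},\ x_j\in X^u_j\}$, and edges $\alpha^{x_i}(x_1,\dots,\widehat{x_i},\dots,x_{k_u})$ with range $s(x_i)$ and source $v(x_1,\dots,x_{k_u})$; the separation is $C^1_v=\{X(x): s(x)=v\}$, where $X(x)$ is the set of all edges of the form $\alpha^{x}(\cdots)$. If the edges of $G$ are coloured blue and red, $\alpha^{x}(\cdots)$ gets the colour of $x$. Let $(E_0,C^0)=(E',C')$, let $(E_{n+1},C^{n+1})$ be the $1$-step resolution of $(E_n,C^n)$, and let $(F,D)=\bigcup_n(E_n,C^n)$, with vertex layers $F^{0,n}=E_n^{0,0}$ and edge layers $F^{1,n}=E_n^1$. Write $R(f)=X(f)$ for red edges $f$ in even layers. *The generalized finite shift $(X,\sigma)$.* $X$ is the space of infinite blue paths $(e_0,e_1,\dots)$, where $e_n\in F^{1,n}$ is blue and $r(e_{n+1})=s(e_n)$, with the topology generated by the cylinder sets. For $x=(e_0,e_1,\dots)\in X$, there is a unique sequence of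 red edges $f_n\in F^{1,n}$ such that, for every $j\ge0$, $$r(f_{2j})=r(e_{2j}),\quad s(f_{2j})=r(f_{2j+1}),\quad s(f_{2j+1})=s(e_{2j+1}),\quad f_{2j+1}\in R(f_{2j}),$$ and a unique $(e_0',e_1',\dots)\in X$ such that, for every $j\ge 0$, $$r(e'_{2j+1})=r(f_{2j+1}),\quad s(e'_{2j+2})=s(f_{2j+2}).$$ One sets $\sigma(x)=(e_0',e_1',\dots)$. Then $(X,\sigma)$ is topologically conjugate to $(X_E,\sigma_E)$: there is a homeomorphism $h:X\to X_E$ with $h\circ\sigma=\sigma_E\circ h$. -/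

import Mathlib

universe u

/-! ### Finite graphs and one-sided edge shifts -/

/-- A directed graph with vertex set `V` and edge set `E`; `r` is the range map and `s` the
source map. Parallel edges and loops are allowed. -/
structure DirectedGraph (V E : Type u) where
  r : E → V
  s : E → V

namespace DirectedGraph

variable {V E : Type u}

/-- Every vertex emits an edge. -/
def NoSinks (Γ : DirectedGraph V E) : Prop := ∀ v, ∃ e, Γ.s e = v

/-- Every vertex receives an edge. -/
def NoSources (Γ : DirectedGraph V E) : Prop := ∀ v, ∃ e, Γ.r e = v

end DirectedGraph

/-- The topology generated by the cylinder sets on a set `S` of sequences `(x₀, x₁, …)`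
with `xₙ` in `A n`. -/
abbrev cylinderTopology {A : ℕ → Type u} (S : Set (∀ n, A n)) : TopologicalSpace S :=
  TopologicalSpace.generateFrom
    {U | ∃ (a : ∀ n, A n) (N : ℕ), U = {x : S | ∀ i ≤ N, x.1 i = a i}}

namespace DirectedGraph

variable {V E : Type u}

/-- The space `X_E` of infinite sequences of edges with `s(eᵢ) = r(eᵢ₊₁)`. -/
def ShiftSpace (Γ : DirectedGraph V E) : Type u :=
  ({x : ℕ → E | ∀ i, Γ.s (x i) = Γ.r (x (i + 1))} : Set (ℕ → E))

instance (Γ : DirectedGraph V E) : TopologicalSpace Γ.ShiftSpace :=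
  cylinderTopology (A := fun _ => E) {x : ℕ → E | ∀ i, Γ.s (x i) = Γ.r (x (i + 1))}

/-- The shift map `σ_E(e₀, e₁, e₂, …) = (e₁, e₂, …)`. -/
def shift (Γ : DirectedGraph V E) (x : Γ.ShiftSpace) : Γ.ShiftSpace :=
  ⟨fun i => x.1 (i + 1), fun i => x.2 (i + 1)⟩

end DirectedGraph

/-! ### Finite bipartite separated graphs and their resolutions -/

/-- A finite (non-empty) bipartite separated graph: `V0` and `V1` are the two layers of vertices,
`E1` is the set of edges, edges go from `V1` to `V0`, with `s(E1) = V1` and `r(E1) = V0`, and for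
each `v` in `V0` the family `C v` is a partition of `r⁻¹(v)` into non-empty subsets. -/
structure BipartiteSeparatedGraph where
  V0 : Type u
  V1 : Type u
  E1 : Type u
  finite_V0 : Finite V0
  finite_V1 : Finite V1
  finite_E1 : Finite E1
  nonempty_V0 : Nonempty V0
  r : E1 → V0
  s : E1 → V1
  r_surj : Function.Surjective r
  s_surj : Function.Surjective s
  C : V0 → Set (Set E1)
  C_nonempty : ∀ v, ∀ Y ∈ C v, Y.Nonempty
  C_range : ∀ v, ∀ Y ∈ C v, ∀ e ∈ Y, r e = v
  C_cover : ∀ e, ∃! Y, Y ∈ C (r e) ∧ e ∈ Y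

namespace BipartiteSeparatedGraph

attribute [instance] finite_V0 finite_V1 finite_E1 nonempty_V0

/-- The vertices `v(x₁, …, xₖ)`: a vertex `u` in `V0` with a choice of one element in each of the
sets belonging to `C u`. -/
abbrev ResVertex (G : BipartiteSeparatedGraph.{u}) : Type u :=
  Σ v : G.V0, ((Y : G.C v) → (Y : Set G.E1))

/-- The edges `α^{xᵢ}(x₁, …, x̂ᵢ, …, xₖ)`: such a vertex `v(x₁, …, xₖ)` with one of the
sets `Xᵢ` in `C u`. -/
abbrev ResEdge (G : BipartiteSeparatedGraph.{u}) : Type u :=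
  Σ w : G.ResVertex, G.C w.1

/-- The edge `xᵢ` of the edge `α^{xᵢ}(x₁, …, x̂ᵢ, …, xₖ)`. -/
def ResEdge.top {G : BipartiteSeparatedGraph.{u}} (α : G.ResEdge) : G.E1 :=
  (α.1.2 α.2 : G.E1)

/-- The set `X(x)` of all edges `α^x(…)`. -/
def resBlock (G : BipartiteSeparatedGraph.{u}) (x : G.E1) : Set G.ResEdge :=
  {α | α.top = x}

theorem exists_top (G : BipartiteSeparatedGraph.{u}) (x : G.E1) :
    ∃ α : G.ResEdge, α.top = x := by
  classical
  obtain ⟨Y, ⟨hY, hx⟩, -⟩ := G.C_cover x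
  have hne : ∀ Z : G.C (G.r x), ∃ z : (Z : Set G.E1), Z = ⟨Y, hY⟩ → (z : G.E1) = x := by
    intro Z
    by_cases h : Z = ⟨Y, hY⟩
    · subst h
      exact ⟨⟨x, hx⟩, fun _ => rfl⟩
    · obtain ⟨z, hz⟩ := G.C_nonempty _ _ Z.2
      exact ⟨⟨z, hz⟩, fun h' => absurd h' h⟩
  choose c hc using hne
  exact ⟨⟨⟨G.r x, c⟩, ⟨Y, hY⟩⟩, hc ⟨Y, hY⟩ rfl⟩

/-- The `1`-step resolution of a finite bipartite separated graph. -/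
def resolution (G : BipartiteSeparatedGraph.{u}) : BipartiteSeparatedGraph.{u} where
  V0 := G.V1
  V1 := G.ResVertex
  E1 := G.ResEdge
  finite_V0 := inferInstance
  finite_V1 := inferInstance
  finite_E1 := inferInstance
  nonempty_V0 := by
    obtain ⟨v⟩ := G.nonempty_V0
    obtain ⟨e, -⟩ := G.r_surj v
    exact ⟨G.s e⟩
  r := fun α => G.s α.top
  s := fun α => α.1
  r_surj := by
    intro v
    obtain ⟨x, rfl⟩ := G.s_surj v
    obtain ⟨α, hα⟩ := G.exists_top x
    exact ⟨α, congrArg G.s hα⟩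
  s_surj := by
    intro w
    obtain ⟨e, he⟩ := G.r_surj w.1
    obtain ⟨Y, ⟨hY, -⟩, -⟩ := G.C_cover e
    exact ⟨⟨w, ⟨Y, he ▸ hY⟩⟩, rfl⟩
  C := fun v => {X | ∃ x, G.s x = v ∧ X = G.resBlock x}
  C_nonempty := by
    rintro v Y ⟨x, -, rfl⟩
    exact G.exists_top x
  C_range := by
    rintro v Y ⟨x, rfl, rfl⟩ α hα
    exact congrArg G.s hα
  C_cover := by
    intro α
    refine ⟨G.resBlock α.top, ⟨⟨α.top, rfl, rfl⟩, rfl⟩, ?_⟩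
    rintro Y ⟨⟨x, -, rfl⟩, hα⟩
    rw [show α.top = x from hα]

/-- The `n`-step resolution. -/
def stepResolution (G : BipartiteSeparatedGraph.{u}) : ℕ → BipartiteSeparatedGraph.{u}
  | 0 => G
  | n + 1 => (stepResolution G n).resolution

end BipartiteSeparatedGraph

/-! ### Separated Bratteli diagrams and `l`-diagrams -/

/-- A separated Bratteli diagram, given layer by layer: finite non-empty vertex layers `V n` and
edge layers `E n`, with `r(E n) = V n` and `s(E n) = V (n + 1)`, and for each `v` in `V n` a
partition `D n v` of `r⁻¹(v)` into non-empty subsets. -/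
structure SeparatedBratteliDiagram where
  V : ℕ → Type u
  E : ℕ → Type u
  finite_V : ∀ n, Finite (V n)
  finite_E : ∀ n, Finite (E n)
  nonempty_V : ∀ n, Nonempty (V n)
  nonempty_E : ∀ n, Nonempty (E n)
  r : ∀ {n}, E n → V n
  s : ∀ {n}, E n → V (n + 1)
  r_surj : ∀ n, Function.Surjective (r : E n → V n)
  s_surj : ∀ n, Function.Surjective (s : E n → V (n + 1))
  D : ∀ n, V n → Set (Set (E n))
  D_nonempty : ∀ n v, ∀ Y ∈ D n v, Y.Nonempty
  D_range : ∀ n v, ∀ Y ∈ D n v, ∀ e ∈ Y, r e = v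
  D_cover : ∀ n (e : E n), ∃! Y, Y ∈ D n (r e) ∧ e ∈ Y

/-- The canonical resolution of a finite bipartite separated graph: its `n`-th layer is the
`n`-step resolution. -/
def BipartiteSeparatedGraph.canonicalResolution (G : BipartiteSeparatedGraph.{u}) :
    SeparatedBratteliDiagram.{u} where
  V n := (G.stepResolution n).V0
  E n := (G.stepResolution n).E1
  finite_V _ := inferInstance
  finite_E _ := inferInstance
  nonempty_V _ := inferInstance
  nonempty_E n := by
    obtain ⟨v⟩ := (G.stepResolution n).nonempty_V0
    obtain ⟨e, -⟩ := (G.stepResolution n).r_surj v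
    exact ⟨e⟩
  r {n} e := (G.stepResolution n).r e
  s {n} e := (G.stepResolution n).s e
  r_surj n := (G.stepResolution n).r_surj
  s_surj n := (G.stepResolution n).s_surj
  D n := (G.stepResolution n).C
  D_nonempty n := (G.stepResolution n).C_nonempty
  D_range n := (G.stepResolution n).C_range
  D_cover n := (G.stepResolution n).C_cover

/-- An `l`-diagram. Even layers are indexed by even `n`; odd layers are written `n + 1` with `n`
even. The data are the set `blue n` of blue edges in each layer (the other edges are red), and the
sets `Rof f` (denoted `R(f)` in the literature), which are used only for the red edges `f` of the
even layers.

The fields `cond_a`-`cond_g` are: (a), (b) the separations at even and odd layers; (c) the vertices at even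
layers; (d) the vertices at the first odd layer, and injectivity of the source map on the blue
edges of an even layer; (e) compatibility at even layers; (f), (g) rombs at odd layers. A disjoint
union being everything is expressed by unique membership. -/
structure LDiagram extends SeparatedBratteliDiagram.{u} where
  blue : ∀ n, Set (E n)
  Rof : ∀ {n}, E n → Set (E (n + 1))
  cond_a : ∀ n, Even n → ∀ v : V n,
    {e | r e = v ∧ e ∈ blue n}.Nonempty ∧ {e | r e = v ∧ e ∉ blue n}.Nonempty ∧
    D n v = {{e | r e = v ∧ e ∈ blue n}, {e | r e = v ∧ e ∉ blue n}}
  cond_b : ∀ n, Even n → ∀ v : V (n + 1),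
    {e | r e = v ∧ e ∈ blue (n + 1)}.Nonempty ∧
    D (n + 1) v = {{e | r e = v ∧ e ∈ blue (n + 1)}} ∪
      {Y | ∃ f : E n, f ∉ blue n ∧ s f = v ∧ Y = Rof f}
  cond_b_red : ∀ n, Even n → ∀ f : E n, f ∉ blue n → ∀ g ∈ Rof f, g ∉ blue (n + 1)
  cond_b_inj : ∀ n, Even n → ∀ f f' : E n, f ∉ blue n → f' ∉ blue n → s f = s f' →
    Rof f = Rof f' → f = f'
  cond_c_blue : ∀ n, Even n → ∀ w : V (n + 2),
    ∃! v : V (n + 1), w ∈ s '' {e | r e = v ∧ e ∈ blue (n + 1)}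
  cond_c_red : ∀ n, Even n → ∀ w : V (n + 2),
    ∃! v : V (n + 1), w ∈ s '' {e | r e = v ∧ e ∉ blue (n + 1)}
  cond_c_blue_inj : ∀ n, Even n → ∀ v : V (n + 1),
    Set.InjOn s {e | r e = v ∧ e ∈ blue (n + 1)}
  cond_c_red_inj : ∀ n, Even n → ∀ v : V (n + 1),
    Set.InjOn s {e | r e = v ∧ e ∉ blue (n + 1)}
  cond_d_blue : ∀ w : V 1, ∃! v : V 0, w ∈ s '' {e | r e = v ∧ e ∈ blue 0}
  cond_d_red : ∀ w : V 1, ∃ v : V 0, w ∈ s '' {e | r e = v ∧ e ∉ blue 0}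
  cond_d_inj : ∀ n, Even n → Set.InjOn s (blue n)
  cond_e : ∀ n, Even n → ∀ v : V n,
    (⋃ e ∈ {e | r e = v ∧ e ∈ blue n}, s '' {e' | r e' = s e ∧ e' ∈ blue (n + 1)}) =
      ⋃ f ∈ {f | r f = v ∧ f ∉ blue n}, s '' Rof f
  cond_e_blue_disj : ∀ n, Even n → ∀ v : V n, {e | r e = v ∧ e ∈ blue n}.PairwiseDisjoint
    fun e => s '' {e' | r e' = s e ∧ e' ∈ blue (n + 1)}
  cond_e_red_disj : ∀ n, Even n → ∀ v : V n, {f | r f = v ∧ f ∉ blue n}.PairwiseDisjoint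
    fun f => s '' Rof f
  cond_f : ∀ n, Even n → ∀ (v : V (n + 1)) (f₀ : E (n + 1)) (f₁ : E (n + 2)),
    f₀ ∉ blue (n + 1) → f₁ ∉ blue (n + 2) → r f₀ = v → s f₀ = r f₁ →
    ∃! p : E (n + 1) × E (n + 2), p.1 ∈ blue (n + 1) ∧ p.2 ∈ blue (n + 2) ∧
      r p.1 = v ∧ s p.1 = r p.2 ∧ s p.2 = s f₁
  cond_g : ∀ n, Even n → ∀ (v : V (n + 1)) (g : E n) (e₀ : E (n + 1)) (e₁ : E (n + 2)),
    g ∉ blue n → s g = v → e₀ ∈ blue (n + 1) → e₁ ∈ blue (n + 2) → r e₀ = v → s e₀ = r e₁ →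
    ∃! p : E (n + 1) × E (n + 2), p.1 ∉ blue (n + 1) ∧ p.2 ∉ blue (n + 2) ∧
      p.1 ∈ Rof g ∧ r p.1 = v ∧ s p.1 = r p.2 ∧ s p.2 = s e₁

namespace LDiagram

variable (F : LDiagram.{u})

/-- The set of infinite blue paths `(e₀, e₁, …)`. -/
def bluePaths : Set (∀ n, F.E n) :=
  {x | ∀ n, x n ∈ F.blue n ∧ F.r (x (n + 1)) = F.s (x n)}

/-- The space `X` of infinite blue paths. -/
def PathSpace : Type u := F.bluePaths

instance : TopologicalSpace F.PathSpace := cylinderTopology F.bluePaths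

/-- `(e₀, e₁, f₀, f₁)` is a romb starting at an even layer. -/
def EvenRomb {n : ℕ} (e₀ : F.E n) (e₁ : F.E (n + 1)) (f₀ : F.E n) (f₁ : F.E (n + 1)) : Prop :=
  f₀ ∉ F.blue n ∧ f₁ ∉ F.blue (n + 1) ∧ F.r f₀ = F.r e₀ ∧ F.s f₀ = F.r f₁ ∧
    F.s f₁ = F.s e₁ ∧ f₁ ∈ F.Rof f₀

/-- `(e₀, e₁, f₀, f₁)` is a romb starting at an odd layer. -/
def OddRomb {n : ℕ} (e₀ : F.E (n + 1)) (e₁ : F.E (n + 2)) (f₀ : F.E (n + 1))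
    (f₁ : F.E (n + 2)) : Prop :=
  e₀ ∈ F.blue (n + 1) ∧ e₁ ∈ F.blue (n + 2) ∧ F.r e₀ = F.r f₀ ∧ F.s e₀ = F.r e₁ ∧
    F.s e₁ = F.s f₁

/-- The relation `y = σ(x)` on infinite blue paths: writing `x = (e₀, e₁, …)` and
`y = (e₀', e₁', …)`, there are red edges `f₀, f₁, …` such that for all `j ≥ 0` the edges
`(e_{2j}, e_{2j+1}, f_{2j}, f_{2j+1})` and `(e'_{2j+1}, e'_{2j+2}, f_{2j+1}, f_{2j+2})` form
rombs. (The blue edge `e₀'` is then the one with `s(e₀') = r(e₁')`.) -/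
def SigmaRel (x y : F.PathSpace) : Prop :=
  ∃ f : ∀ n, F.E n, ∀ n, Even n →
    F.EvenRomb (x.1 n) (x.1 (n + 1)) (f n) (f (n + 1)) ∧
    F.OddRomb (y.1 (n + 1)) (y.1 (n + 2)) (f (n + 1)) (f (n + 2))

variable {F}

theorem existsUnique_evenRomb {n : ℕ} (hn : Even n) (e₀ : F.E n) (e₁ : F.E (n + 1))
    (h₀ : e₀ ∈ F.blue n) (h₁ : e₁ ∈ F.blue (n + 1)) (h : F.r e₁ = F.s e₀) :
    ∃! p : F.E n × F.E (n + 1), F.EvenRomb e₀ e₁ p.1 p.2 := by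
  have hE := F.cond_e n hn (F.r e₀)
  have hmem : F.s e₁ ∈ ⋃ f ∈ {f | F.r f = F.r e₀ ∧ f ∉ F.blue n}, F.s '' F.Rof f := by
    rw [← hE]
    exact Set.mem_biUnion (show e₀ ∈ _ from ⟨rfl, h₀⟩) ⟨e₁, ⟨h, h₁⟩, rfl⟩
  obtain ⟨f₀, ⟨hr, hf₀⟩, f₁, hf₁, hs⟩ := Set.mem_iUnion₂.1 hmem
  have hR : ∀ f : F.E n, f ∉ F.blue n → ∀ g ∈ F.Rof f, F.r g = F.s f := by
    intro f hf g hg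
    refine F.D_range (n + 1) (F.s f) (F.Rof f) ?_ g hg
    rw [(F.cond_b n hn (F.s f)).2]
    exact Or.inr ⟨f, hf, rfl, rfl⟩
  refine ⟨(f₀, f₁), ⟨hf₀, F.cond_b_red n hn f₀ hf₀ f₁ hf₁, hr, (hR f₀ hf₀ f₁ hf₁).symm, hs, hf₁⟩,
    ?_⟩
  rintro ⟨g₀, g₁⟩ ⟨k₀, k₁, kr, ks, ks', kR⟩
  have h0 : g₀ = f₀ := by
    by_contra hne
    have := F.cond_e_red_disj n hn (F.r e₀) (show g₀ ∈ _ from ⟨kr, k₀⟩)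
      (show f₀ ∈ _ from ⟨hr, hf₀⟩) hne
    exact Set.disjoint_left.1 this ⟨g₁, kR, ks'⟩ ⟨f₁, hf₁, hs⟩
  subst h0
  have h1 : g₁ = f₁ :=
    F.cond_c_red_inj n hn (F.s g₀) ⟨ks.symm, k₁⟩
      ⟨hR g₀ hf₀ f₁ hf₁, F.cond_b_red n hn g₀ hf₀ f₁ hf₁⟩ (ks'.trans hs.symm)
  rw [h1]

theorem exists_pairs {A : ℕ → Type u} (P : ∀ n, A n → A (n + 1) → Prop)
    (h : ∀ n, Even n → ∃ a b, P n a b) :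
    ∃ f : ∀ n, A n, ∀ n, Even n → P n (f n) (f (n + 1)) := by
  classical
  choose p q hpq using h
  have hodd : ∀ n, ¬ Even n → Even (n + 1) := fun n hn => by
    rw [Nat.even_add_one]; exact hn
  let f : ∀ n, A n := fun n => match n with
    | 0 => p 0 Even.zero
    | n + 1 => if hn : Even n then q n hn else p (n + 1) (hodd n hn)
  refine ⟨f, fun n hn => ?_⟩
  have h1 : f (n + 1) = q n hn := dif_pos hn
  have h0 : f n = p n hn := by
    cases n with
    | zero => rfl
    | succ m => exact dif_neg (by rw [Nat.even_add_one] at hn; exact hn)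
  rw [h0, h1]
  exact hpq n hn

theorem existsUnique_sigmaRel (x : F.PathSpace) : ∃! y, F.SigmaRel x y := by
  have hx : ∀ n, x.1 n ∈ F.blue n ∧ F.r (x.1 (n + 1)) = F.s (x.1 n) := x.2
  obtain ⟨f, hf⟩ := exists_pairs (A := F.E)
    (fun n a b => F.EvenRomb (x.1 n) (x.1 (n + 1)) a b) (fun n hn => by
      obtain ⟨p, hp, -⟩ := existsUnique_evenRomb hn _ _ (hx n).1 (hx (n + 1)).1 (hx n).2
      exact ⟨p.1, p.2, hp⟩)
  have hf2 : ∀ n, Even n → Even (n + 2) := fun n hn => hn.add even_two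
  have hodd : ∀ n, Even n → ∃! p : F.E (n + 1) × F.E (n + 2),
      F.OddRomb p.1 p.2 (f (n + 1)) (f (n + 2)) := by
    intro n hn
    have h1 := hf n hn
    have h2 := hf (n + 2) (hf2 n hn)
    refine F.cond_f n hn (F.r (f (n + 1))) (f (n + 1)) (f (n + 2)) h1.2.1 h2.1 rfl ?_
    rw [h1.2.2.2.2.1, h2.2.2.1, (hx (n + 1)).2]
  obtain ⟨z, hz⟩ := exists_pairs (A := fun n => F.E (n + 1))
    (fun n a b => F.OddRomb a b (f (n + 1)) (f (n + 2))) (fun n hn => by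
      obtain ⟨p, hp, -⟩ := hodd n hn
      exact ⟨p.1, p.2, hp⟩)
  obtain ⟨v, ⟨e, ⟨-, he⟩, hse⟩, -⟩ := F.cond_d_blue (F.r (z 0))
  let y : ∀ n, F.E n := fun n => match n with
    | 0 => e
    | n + 1 => z n
  have hy : y ∈ F.bluePaths := by
    intro n
    cases n with
    | zero => exact ⟨he, hse.symm⟩
    | succ m =>
      by_cases hm : Even m
      · exact ⟨(hz m hm).1, (hz m hm).2.2.2.1.symm⟩
      · cases m with
        | zero => exact absurd Even.zero hm
        | succ k =>
          have hk : Even k := by rw [Nat.even_add_one, not_not] at hm; exact hm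
          have h1 := hz k hk
          have h2 := hz (k + 2) (hf2 k hk)
          refine ⟨h1.2.1, ?_⟩
          have h3 := hf (k + 2) (hf2 k hk)
          exact h2.2.2.1.trans (h3.2.2.2.1.symm.trans h1.2.2.2.2.symm)
  refine ⟨⟨y, hy⟩, ⟨f, fun n hn => ⟨hf n hn, hz n hn⟩⟩, ?_⟩
  rintro ⟨w, hw⟩ ⟨g, hg⟩
  have hgf : ∀ n, Even n → g n = f n ∧ g (n + 1) = f (n + 1) := by
    intro n hn
    have := (existsUnique_evenRomb hn _ _ (hx n).1 (hx (n + 1)).1 (hx n).2).unique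
      (y₁ := (g n, g (n + 1))) (y₂ := (f n, f (n + 1))) (hg n hn).1 (hf n hn)
    exact ⟨congrArg Prod.fst this, congrArg Prod.snd this⟩
  have hwy : ∀ n, Even n → w (n + 1) = y (n + 1) ∧ w (n + 2) = y (n + 2) := by
    intro n hn
    have hO := (hg n hn).2
    rw [(hgf n hn).2, (hgf (n + 2) (hf2 n hn)).1] at hO
    have := (hodd n hn).unique (y₁ := (w (n + 1), w (n + 2)))
      (y₂ := (y (n + 1), y (n + 2))) hO (hz n hn)
    exact ⟨congrArg Prod.fst this, congrArg Prod.snd this⟩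
  have hw' : ∀ n, w n = y n := by
    intro n
    cases n with
    | zero =>
      refine F.cond_d_inj 0 Even.zero (hw 0).1 (hy 0).1 ?_
      rw [← (hw 0).2, ← (hy 0).2, (hwy 0 Even.zero).1]
    | succ m =>
      by_cases hm : Even m
      · exact (hwy m hm).1
      · cases m with
        | zero => exact absurd Even.zero hm
        | succ k =>
          have hk : Even k := by rw [Nat.even_add_one, not_not] at hm; exact hm
          exact (hwy k hk).2
  exact Subtype.ext (funext hw')

variable (F)

/-- The map `σ : X → X` associated with an `l`-diagram. -/
noncomputable def sigma (x : F.PathSpace) : F.PathSpace := (existsUnique_sigmaRel x).choose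

theorem sigma_spec (x : F.PathSpace) : F.SigmaRel x (F.sigma x) :=
  (existsUnique_sigmaRel x).choose_spec.1

end LDiagram

/-! ### Generalized finite shifts -/

namespace BipartiteSeparatedGraph

/-- `G` is a generalized finite shift graph, where the blue edges are those in `blue` and the red
edges are the others; `B_v` and `R_v` are the sets of blue, respectively red, edges with
range `v`. -/
structure IsShiftGraph (G : BipartiteSeparatedGraph.{u}) (blue : Set G.E1) : Prop where
  blue_nonempty : ∀ v, {e | G.r e = v ∧ e ∈ blue}.Nonempty
  red_nonempty : ∀ v, {e | G.r e = v ∧ e ∉ blue}.Nonempty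
  C_eq : ∀ v, G.C v = {{e | G.r e = v ∧ e ∈ blue}, {e | G.r e = v ∧ e ∉ blue}}
  s_blue : ∀ w, ∃! v, w ∈ G.s '' {e | G.r e = v ∧ e ∈ blue}
  s_red : ∀ w, ∃ v, w ∈ G.s '' {e | G.r e = v ∧ e ∉ blue}
  s_inj : ∀ v, Set.InjOn G.s {e | G.r e = v ∧ e ∈ blue}

/-- Colours in the `1`-step resolution: `α^x(…)` has the colour of `x`. -/
def resBlue (G : BipartiteSeparatedGraph.{u}) (blue : Set G.E1) : Set G.resolution.E1 :=
  {α : G.ResEdge | α.top ∈ blue}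

/-- Colours in the `n`-step resolution. -/
def stepBlue (G : BipartiteSeparatedGraph.{u}) (blue : Set G.E1) :
    (n : ℕ) → Set (G.stepResolution n).E1
  | 0 => blue
  | n + 1 => (G.stepResolution n).resBlue (stepBlue G blue n)

/-- Auxiliary: every vertex in `V1` emits exactly one blue edge, and at every vertex in `V0`
exactly one set of the separation is blue. -/
def Good (G : BipartiteSeparatedGraph.{u}) (b : Set G.E1) : Prop :=
  (∀ w, ∃! e, G.s e = w ∧ e ∈ b) ∧
    ∀ v, ∃ Y ∈ G.C v, ∀ Z ∈ G.C v, ∀ z ∈ Z, (z ∈ b ↔ Z = Y)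

section

variable {G : BipartiteSeparatedGraph.{u}} {b : Set G.E1}

theorem IsShiftGraph.good (h : G.IsShiftGraph b) : G.Good b := by
  constructor
  · intro w
    obtain ⟨v, ⟨e, ⟨rfl, he⟩, hs⟩, hv⟩ := h.s_blue w
    refine ⟨e, ⟨hs, he⟩, ?_⟩
    rintro e' ⟨hs', he'⟩
    have hr := hv (G.r e') ⟨e', ⟨rfl, he'⟩, hs'⟩
    exact h.s_inj (G.r e) ⟨hr, he'⟩ ⟨rfl, he⟩ (hs'.trans hs.symm)
  · intro v
    refine ⟨{e | G.r e = v ∧ e ∈ b}, by rw [h.C_eq]; exact Or.inl rfl, ?_⟩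
    intro Z hZ z hz
    rw [h.C_eq] at hZ
    rcases hZ with rfl | hZ
    · exact ⟨fun _ => rfl, fun _ => hz.2⟩
    · rw [Set.mem_singleton_iff] at hZ
      subst hZ
      exact ⟨fun hb => absurd hb hz.2, fun hE => by rw [hE] at hz; exact hz.2⟩

theorem Good.resolution_src (h : G.Good b) (w : G.ResVertex) :
    ∃! α : G.ResEdge, α.1 = w ∧ α.top ∈ b := by
  obtain ⟨Y, hY, hZ⟩ := h.2 w.1
  refine ⟨⟨w, ⟨Y, hY⟩⟩, ⟨rfl, (hZ Y hY _ (w.2 ⟨Y, hY⟩).2).2 rfl⟩, ?_⟩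
  rintro ⟨w', ⟨Z, hZ'⟩⟩ ⟨rfl, hb⟩
  have : Z = Y := (hZ Z hZ' _ (w'.2 ⟨Z, hZ'⟩).2).1 hb
  subst this
  rfl

theorem resBlock_injective (G : BipartiteSeparatedGraph.{u}) {x y : G.E1}
    (h : G.resBlock x = G.resBlock y) : x = y := by
  obtain ⟨α, hα⟩ := G.exists_top x
  have : α ∈ G.resBlock y := h ▸ (show α ∈ G.resBlock x from hα)
  exact hα.symm.trans this

theorem Good.resolution (h : G.Good b) : G.resolution.Good (G.resBlue b) := by
  refine ⟨h.resolution_src, ?_⟩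
  intro v
  obtain ⟨e, ⟨hs, he⟩, hu⟩ := h.1 v
  refine ⟨G.resBlock e, ⟨e, hs, rfl⟩, ?_⟩
  rintro Z ⟨x, hx, rfl⟩ α (hα : α.top = x)
  show α.top ∈ b ↔ _
  rw [hα]
  constructor
  · intro hb
    rw [hu x ⟨hx, hb⟩]
  · intro hE
    rw [resBlock_injective G hE]
    exact he

/-- The set of blue edges at a vertex of the resolution is `X(e)`, with `e` the blue edge
emitted by it. -/
theorem Good.blue_block (h : G.Good b) {v : G.V1} {e : G.E1} (hs : G.s e = v) (he : e ∈ b) :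
    {α : G.ResEdge | G.s α.top = v ∧ α.top ∈ b} = G.resBlock e := by
  ext α
  constructor
  · rintro ⟨h1, h2⟩
    exact (h.1 v).unique ⟨h1, h2⟩ ⟨hs, he⟩
  · intro hα
    have : α.top = e := hα
    exact ⟨by rw [this, hs], by rw [this]; exact he⟩

theorem IsShiftGraph.block_red (h : G.IsShiftGraph b) {v : G.V0} {Y Z : Set G.E1}
    (hY : Y ∈ G.C v) (hZ : Z ∈ G.C v) {y z : G.E1} (hy : y ∈ Y) (hz : z ∈ Z)
    (hy' : y ∉ b) (hz' : z ∉ b) : Y = Z := by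
  rw [h.C_eq] at hY hZ
  rcases hY with rfl | rfl
  · exact absurd hy.2 hy'
  rcases hZ with rfl | rfl
  · exact absurd hz.2 hz'
  rfl

theorem IsShiftGraph.resolution_red_src (h : G.IsShiftGraph b) (w : G.ResVertex) :
    ∃! α : G.ResEdge, α.1 = w ∧ α.top ∉ b := by
  have hR : {e | G.r e = w.1 ∧ e ∉ b} ∈ G.C w.1 := by rw [h.C_eq]; exact Or.inr rfl
  refine ⟨⟨w, ⟨_, hR⟩⟩, ⟨rfl, (w.2 ⟨_, hR⟩).2.2⟩, ?_⟩
  rintro ⟨w', ⟨Z, hZ⟩⟩ ⟨rfl, hb⟩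
  have := h.block_red hZ hR (w'.2 ⟨Z, hZ⟩).2 (w'.2 ⟨_, hR⟩).2 hb (w'.2 ⟨_, hR⟩).2.2
  exact congrArg (Sigma.mk w') (Subtype.ext this)

theorem IsShiftGraph.resolution₂ (h : G.IsShiftGraph b) :
    G.resolution.resolution.IsShiftGraph (G.resolution.resBlue (G.resBlue b)) := by
  have g0 := h.good
  have g1 := g0.resolution
  have g2 := g1.resolution
  have hB : ∀ v : G.resolution.V1, ∃ α : G.resolution.E1, G.resolution.s α = v ∧
      α ∈ G.resBlue b ∧
      {β : G.resolution.ResEdge | G.resolution.s β.top = v ∧ β.top ∈ G.resBlue b} =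
        G.resolution.resBlock α := by
    intro v
    obtain ⟨α, ⟨hs, hb⟩, -⟩ := g1.1 v
    exact ⟨α, hs, hb, g1.blue_block hs hb⟩
  have hR : ∀ v : G.resolution.V1, ∃ α : G.resolution.E1, G.resolution.s α = v ∧
      α ∉ G.resBlue b ∧
      {β : G.resolution.ResEdge | G.resolution.s β.top = v ∧ β.top ∉ G.resBlue b} =
        G.resolution.resBlock α := by
    intro v
    obtain ⟨α, ⟨hs, hb⟩, hu⟩ := h.resolution_red_src v
    refine ⟨α, hs, hb, ?_⟩
    ext β
    constructor
    · rintro ⟨h1, h2⟩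
      exact hu _ ⟨h1, h2⟩
    · intro hβ
      have : β.top = α := hβ
      refine ⟨by rw [this]; exact hs, by rw [this]; exact hb⟩
  constructor
  · intro v
    obtain ⟨α, hs, hb, hE⟩ := hB v
    obtain ⟨β, hβ⟩ := G.resolution.exists_top α
    exact ⟨β, (Set.ext_iff.1 hE β).2 hβ⟩
  · intro v
    obtain ⟨α, hs, hb, hE⟩ := hR v
    obtain ⟨β, hβ⟩ := G.resolution.exists_top α
    exact ⟨β, (Set.ext_iff.1 hE β).2 hβ⟩
  · intro v
    obtain ⟨α, hs, hb, hE⟩ := hB v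
    obtain ⟨α', hs', hb', hE'⟩ := hR v
    refine Eq.trans ?_ (congrArg₂ (fun A B => ({A, B} : Set (Set G.resolution.ResEdge)))
      hE hE').symm
    ext X
    constructor
    · rintro ⟨x, hx, rfl⟩
      by_cases hxb : x ∈ G.resBlue b
      · exact Or.inl (congrArg _ ((g1.1 v).unique ⟨hx, hxb⟩ ⟨hs, hb⟩))
      · exact Or.inr (congrArg _ ((h.resolution_red_src v).unique ⟨hx, hxb⟩ ⟨hs', hb'⟩))
    · rintro (rfl | rfl)
      · exact ⟨α, hs, rfl⟩
      · exact ⟨α', hs', rfl⟩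
  · intro w
    obtain ⟨β, ⟨hs, hb⟩, hu⟩ := g2.1 w
    refine ⟨_, ⟨β, ⟨rfl, hb⟩, hs⟩, ?_⟩
    rintro v ⟨β', ⟨rfl, hb'⟩, hs'⟩
    rw [hu β' ⟨hs', hb'⟩]
  · intro w
    obtain ⟨f, hf⟩ : ∃ f : G.E1, G.s f = w.1 ∧ f ∉ b := by
      obtain ⟨v, f, ⟨-, hf⟩, hs⟩ := h.s_red w.1
      exact ⟨f, hs, hf⟩
    let Y : G.resolution.C w.1 := ⟨G.resBlock f, f, hf.1, rfl⟩
    let β : G.resolution.ResEdge := ⟨w, Y⟩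
    refine ⟨_, β, ⟨rfl, ?_⟩, rfl⟩
    have : (show G.ResEdge from β.top).top = f := (w.2 Y).2
    intro hmem
    have hmem' : (show G.ResEdge from β.top).top ∈ b := hmem
    rw [this] at hmem'
    exact hf.2 hmem'
  · rintro v β ⟨-, hb⟩ β' ⟨-, hb'⟩ hs
    exact (g2.1 _).unique ⟨hs, hb⟩ ⟨rfl, hb'⟩

theorem IsShiftGraph.step (h : G.IsShiftGraph b) :
    ∀ n, Even n → (G.stepResolution n).IsShiftGraph (G.stepBlue b n) := by
  intro n hn
  obtain ⟨k, rfl⟩ := hn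
  induction k with
  | zero => exact h
  | succ k ih =>
    have : k + 1 + (k + 1) = (k + k) + 2 := by ring
    rw [this]
    exact ih.resolution₂

end

/-- The canonical resolution of a generalized finite shift graph, as an `l`-diagram. The set
`R(f)` is `X(f)`. The generalized finite shift of `G` is the system `(PathSpace, sigma)` of this
`l`-diagram. -/
def lDiagram (G : BipartiteSeparatedGraph.{u}) (blue : Set G.E1) (h : G.IsShiftGraph blue) :
    LDiagram.{u} where
  toSeparatedBratteliDiagram := G.canonicalResolution
  blue n := G.stepBlue blue n
  Rof {n} f := (G.stepResolution n).resBlock f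
  cond_a n hn v :=
    ⟨(h.step n hn).blue_nonempty v, (h.step n hn).red_nonempty v, (h.step n hn).C_eq v⟩
  cond_b n hn v := by
    have g0 := (h.step n hn).good
    obtain ⟨e, ⟨hs, he⟩, hu⟩ := g0.1 v
    have hE := g0.blue_block hs he
    constructor
    · obtain ⟨α, hα⟩ := (G.stepResolution n).exists_top e
      exact ⟨α, (Set.ext_iff.1 hE α).2 hα⟩
    · refine Eq.trans ?_ (congrArg (fun A => ({A} : Set (Set (G.stepResolution n).ResEdge)) ∪
        {Y | ∃ f, f ∉ G.stepBlue blue n ∧ (G.stepResolution n).s f = v ∧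
          Y = (G.stepResolution n).resBlock f}) hE).symm
      ext X
      constructor
      · rintro ⟨x, hx, rfl⟩
        by_cases hb : x ∈ G.stepBlue blue n
        · exact Or.inl (congrArg _ (hu x ⟨hx, hb⟩))
        · exact Or.inr ⟨x, hb, hx, rfl⟩
      · rintro (rfl | ⟨f, -, hf, rfl⟩)
        · exact ⟨e, hs, rfl⟩
        · exact ⟨f, hf, rfl⟩
  cond_b_red n hn f hf g hg := by
    have : BipartiteSeparatedGraph.ResEdge.top g = f := hg
    intro hmem
    have h' : BipartiteSeparatedGraph.ResEdge.top g ∈ G.stepBlue blue n := hmem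
    rw [this] at h'
    exact hf h'
  cond_b_inj n _ f f' _ _ _ hE := resBlock_injective _ hE
  cond_c_blue n hn w := by
    obtain ⟨α, ⟨hs, hb⟩, hu⟩ := (h.step n hn).good.resolution_src w
    refine ⟨_, ⟨α, ⟨rfl, hb⟩, hs⟩, ?_⟩
    rintro v ⟨α', ⟨rfl, hb'⟩, hs'⟩
    rw [hu α' ⟨hs', hb'⟩]
  cond_c_red n hn w := by
    obtain ⟨α, ⟨hs, hb⟩, hu⟩ := (h.step n hn).resolution_red_src w
    refine ⟨_, ⟨α, ⟨rfl, hb⟩, hs⟩, ?_⟩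
    rintro v ⟨α', ⟨rfl, hb'⟩, hs'⟩
    rw [hu α' ⟨hs', hb'⟩]
  cond_c_blue_inj n hn v := by
    rintro α ⟨-, hb⟩ α' ⟨-, hb'⟩ hs
    exact ((h.step n hn).good.resolution_src _).unique ⟨hs, hb⟩ ⟨rfl, hb'⟩
  cond_c_red_inj n hn v := by
    rintro α ⟨-, hb⟩ α' ⟨-, hb'⟩ hs
    exact ((h.step n hn).resolution_red_src _).unique ⟨hs, hb⟩ ⟨rfl, hb'⟩
  cond_d_blue := h.s_blue
  cond_d_red := h.s_red
  cond_d_inj n hn := by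
    intro e he e' he' hs
    exact ((h.step n hn).good.1 _).unique ⟨hs, he⟩ ⟨rfl, he'⟩
  cond_e n hn v := by
    have hn' := h.step n hn
    ext w
    simp only [Set.mem_iUnion₂]
    constructor
    · rintro ⟨e, ⟨hr, he⟩, α, ⟨hα, hb⟩, hs⟩
      have h1 : BipartiteSeparatedGraph.ResEdge.top α = e :=
        (hn'.good.1 _).unique ⟨hα, hb⟩ ⟨rfl, he⟩
      have hw : w.1 = v := by
        rw [← hs, ← hr, ← h1]
        exact ((G.stepResolution n).C_range _ _ α.2.2 _ (α.1.2 α.2).2).symm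
      obtain ⟨β, ⟨hβ, hβb⟩, -⟩ := hn'.resolution_red_src w
      refine ⟨β.top, ⟨?_, hβb⟩, β, rfl, hβ⟩
      refine ((G.stepResolution n).C_range _ _ β.2.2 _ (β.1.2 β.2).2).trans ?_
      rw [hβ, hw]
    · rintro ⟨f, ⟨hr, hf⟩, β, hβ, hs⟩
      have h1 : BipartiteSeparatedGraph.ResEdge.top β = f := hβ
      have hw : w.1 = v := by
        rw [← hs, ← hr, ← h1]
        exact ((G.stepResolution n).C_range _ _ β.2.2 _ (β.1.2 β.2).2).symm
      obtain ⟨α, ⟨hα, hαb⟩, -⟩ := hn'.good.resolution_src w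
      refine ⟨α.top, ⟨?_, hαb⟩, α, ⟨rfl, hαb⟩, hα⟩
      refine ((G.stepResolution n).C_range _ _ α.2.2 _ (α.1.2 α.2).2).trans ?_
      rw [hα, hw]
  cond_e_blue_disj n hn v := by
    have hn' := h.step n hn
    rintro e ⟨-, he⟩ e' ⟨-, he'⟩ hne
    refine Set.disjoint_left.2 ?_
    rintro w ⟨α, ⟨hα, hb⟩, hs⟩ ⟨α', ⟨hα', hb'⟩, hs'⟩
    have : α = α' := (hn'.good.resolution_src w).unique ⟨hs, hb⟩ ⟨hs', hb'⟩
    subst this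
    exact hne ((hn'.good.1 _).unique ⟨hα.symm, he⟩ ⟨hα'.symm, he'⟩)
  cond_e_red_disj n hn v := by
    have hn' := h.step n hn
    rintro f ⟨-, hf⟩ f' ⟨-, hf'⟩ hne
    refine Set.disjoint_left.2 ?_
    rintro w ⟨α, hα, hs⟩ ⟨α', hα', hs'⟩
    have h1 : BipartiteSeparatedGraph.ResEdge.top α = f := hα
    have h2 : BipartiteSeparatedGraph.ResEdge.top α' = f' := hα'
    have : α = α' := (hn'.resolution_red_src w).unique ⟨hs, by rw [h1]; exact hf⟩
      ⟨hs', by rw [h2]; exact hf'⟩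
    subst this
    exact hne (h1.symm.trans h2)
  cond_f n hn v f₀ f₁ h₀ h₁ hv hs := by
    have hn' := h.step n hn
    have g1 := hn'.good.resolution
    obtain ⟨e₁, ⟨hs₁, hb₁⟩, hu⟩ := g1.resolution_src f₁.1
    have hf : BipartiteSeparatedGraph.ResEdge.top f₁ = f₀ :=
      (hn'.resolution_red_src _).unique ⟨hs.symm, h₁⟩ ⟨rfl, h₀⟩
    refine ⟨(e₁.top, e₁), ⟨hb₁, hb₁, ?_, rfl, hs₁⟩, ?_⟩
    · have r1 := ((G.stepResolution n).resolution).C_range _ _ e₁.2.2 _ (e₁.1.2 e₁.2).2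
      have r2 := ((G.stepResolution n).resolution).C_range _ _ f₁.2.2 _ (f₁.1.2 f₁.2).2
      refine r1.trans (Eq.trans (by rw [hs₁]) (r2.symm.trans ?_))
      exact Eq.trans (congrArg (G.stepResolution n).resolution.r hf) hv
    · rintro ⟨p, q⟩ ⟨hp, hq, -, hpq, hq'⟩
      have h1 : q = e₁ := hu q ⟨hq', hq⟩
      subst h1
      have h2 : p = BipartiteSeparatedGraph.ResEdge.top q :=
        (hn'.good.resolution_src _).unique ⟨hpq, hp⟩ ⟨rfl, hb₁⟩
      rw [h2]
      rfl
  cond_g n hn v g e₀ e₁ hg hgv h₀ h₁ hv hs := by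
    have hn' := h.step n hn
    have he : BipartiteSeparatedGraph.ResEdge.top e₁ = e₀ :=
      (hn'.good.resolution_src _).unique ⟨hs.symm, h₁⟩ ⟨rfl, h₀⟩
    have r1 := ((G.stepResolution n).resolution).C_range _ _ e₁.2.2 _ (e₁.1.2 e₁.2).2
    have hv1 : e₁.1.1 = v :=
      r1.symm.trans (Eq.trans (congrArg (G.stepResolution n).resolution.r he) hv)
    let Y : (G.stepResolution n).resolution.C e₁.1.1 :=
      ⟨(G.stepResolution n).resBlock g, g, hgv.trans hv1.symm, rfl⟩
    let f₁ : (G.stepResolution n).resolution.ResEdge := ⟨e₁.1, Y⟩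
    have hf : BipartiteSeparatedGraph.ResEdge.top (show (G.stepResolution n).ResEdge from f₁.top)
        = g := (e₁.1.2 Y).2
    have hred : f₁.top ∉ (G.stepResolution n).resBlue (G.stepBlue blue n) := by
      intro hmem
      have h' : BipartiteSeparatedGraph.ResEdge.top
        (show (G.stepResolution n).ResEdge from f₁.top) ∈ G.stepBlue blue n := hmem
      rw [hf] at h'
      exact hg h'
    refine ⟨(f₁.top, f₁), ⟨hred, hred, hf, ?_, rfl, rfl⟩, ?_⟩
    · exact Eq.trans (congrArg (G.stepResolution n).s hf) hgv
    · rintro ⟨p, q⟩ ⟨hp, hq, hpg, -, hpq, hqs⟩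
      have h2 : BipartiteSeparatedGraph.ResEdge.top q = p :=
        (hn'.resolution_red_src _).unique ⟨hpq.symm, hq⟩ ⟨rfl, hp⟩
      have h3 : q = f₁ := by
        obtain ⟨w, ⟨Z, hZ⟩⟩ := q
        have hw : w = e₁.1 := hqs
        subst hw
        obtain ⟨x, hx, rfl⟩ := hZ
        have hx' : BipartiteSeparatedGraph.ResEdge.top (show (G.stepResolution n).ResEdge from p)
            = x := by
          rw [← h2]
          exact (e₁.1.2 ⟨_, x, hx, rfl⟩).2
        have hpg' : BipartiteSeparatedGraph.ResEdge.top
          (show (G.stepResolution n).ResEdge from p) = g := hpg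
        have : x = g := hx'.symm.trans hpg'
        subst this
        rfl
      subst h3
      rw [← h2]
      rfl

end BipartiteSeparatedGraph

/-! ### The separated graph of a finite graph -/

namespace DirectedGraph

variable {V E : Type u} [Finite V] [Finite E] [Nonempty V]

/-- The separated graph `(E', C')` associated with a finite graph `E` without sinks and sources:
its two vertex layers are copies `v^i`, `v_i` of the vertex set; there is one blue edge
`inl i` from `v_i` to `v^i` for each vertex `i`, and one red edge `inr f` from `v_{s(f)}` to
`v^{r(f)}` for each edge `f`. -/
def separatedGraph (Γ : DirectedGraph V E) (hr : Γ.NoSources) : BipartiteSeparatedGraph.{u} where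
  V0 := V
  V1 := V
  E1 := V ⊕ E
  finite_V0 := inferInstance
  finite_V1 := inferInstance
  finite_E1 := inferInstance
  nonempty_V0 := inferInstance
  r := Sum.elim id Γ.r
  s := Sum.elim id Γ.s
  r_surj := fun v => ⟨Sum.inl v, rfl⟩
  s_surj := fun v => ⟨Sum.inl v, rfl⟩
  C := fun i => {{Sum.inl i}, {x | ∃ f, Γ.r f = i ∧ x = Sum.inr f}}
  C_nonempty := by
    rintro v Y (rfl | rfl)
    · exact ⟨_, rfl⟩
    · obtain ⟨f, hf⟩ := hr v
      exact ⟨Sum.inr f, f, hf, rfl⟩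
  C_range := by
    rintro v Y (rfl | rfl) e he
    · rw [Set.mem_singleton_iff] at he
      subst he
      rfl
    · obtain ⟨f, hf, rfl⟩ := he
      exact hf
  C_cover := by
    rintro (i | f)
    · refine ⟨{Sum.inl i}, ⟨Or.inl rfl, rfl⟩, ?_⟩
      rintro Y ⟨rfl | rfl, h⟩
      · rfl
      · obtain ⟨f, -, hf⟩ := h
        exact absurd hf Sum.inl_ne_inr
    · refine ⟨_, ⟨Or.inr rfl, f, rfl, rfl⟩, ?_⟩
      rintro Y ⟨rfl | rfl, h⟩
      · exact absurd h Sum.inr_ne_inl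
      · rfl

/-- The blue edges of `(E', C')`. -/
def separatedBlue (Γ : DirectedGraph V E) (hr : Γ.NoSources) : Set (Γ.separatedGraph hr).E1 :=
  Set.range (Sum.inl : V → V ⊕ E)

/-- `(E', C')` is a generalized finite shift graph. -/
theorem isShiftGraph (Γ : DirectedGraph V E) (hs : Γ.NoSinks) (hr : Γ.NoSources) :
    (Γ.separatedGraph hr).IsShiftGraph (Γ.separatedBlue hr) where
  blue_nonempty v := ⟨Sum.inl v, rfl, v, rfl⟩
  red_nonempty v := by
    obtain ⟨f, hf⟩ := hr v
    exact ⟨Sum.inr f, hf, by rintro ⟨i, hi⟩; exact Sum.inl_ne_inr hi⟩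
  C_eq v := by
    refine congrArg₂ (fun A B => ({A, B} : Set (Set (V ⊕ E)))) ?_ ?_
    · ext x
      constructor
      · rintro rfl
        exact ⟨rfl, v, rfl⟩
      · rintro ⟨h, i, rfl⟩
        exact congrArg Sum.inl h
    · ext x
      constructor
      · rintro ⟨f, hf, rfl⟩
        exact ⟨hf, by rintro ⟨i, hi⟩; exact Sum.inl_ne_inr hi⟩
      · rintro ⟨h, hx⟩
        cases x with
        | inl i => exact absurd ⟨i, rfl⟩ hx
        | inr f => exact ⟨f, h, rfl⟩
  s_blue w := by
    refine ⟨w, ⟨Sum.inl w, ⟨rfl, w, rfl⟩, rfl⟩, ?_⟩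
    rintro v ⟨x, ⟨rfl, i, rfl⟩, h⟩
    exact h
  s_red w := by
    obtain ⟨f, hf⟩ := hs w
    exact ⟨Γ.r f, Sum.inr f, ⟨rfl, by rintro ⟨i, hi⟩; exact Sum.inl_ne_inr hi⟩, hf⟩
  s_inj v := by
    rintro x ⟨-, i, rfl⟩ y ⟨-, j, rfl⟩ h
    exact congrArg Sum.inl h

end DirectedGraph

/-- Topological conjugacy of the dynamical systems `(X, σ)` and `(Y, τ)`: there is a
homeomorphism intertwining `σ` and `τ`. -/
def TopologicallyConjugate {X Y : Type u} [TopologicalSpace X] [TopologicalSpace Y]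
    (σ : X → X) (τ : Y → Y) : Prop :=
  ∃ h : X ≃ₜ Y, h ∘ σ = τ ∘ h

/-! Record for a blue path x the first red edge of x, of σ(x), of σ²(x), and so on
(`LDiagram.code`). Passing from x to σ(x) deletes the first letter, so this coding turns σ into a
shift. Consecutive letters are linked by a blue edge of layer 0 (`exists_blue_code`). In (E', C')
the red edges of layer 0 are the edges of E and the blue edges are the edges v_i → v^i, so the
linking condition reads s(fₙ) = r(fₙ₊₁), and codes are points of X_E.

The coding is local in any `l`-diagram: letters 0, …, n depend only on the edges of x in layers
below 2(n+1) (`code_congr`). The converse, `Rigid.eq_of_code_eq`, needs the diagram to have few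
edges (`Rigid`): a letter then fixes the first two edges of x, and together with σ(x) it fixes the
rest, two layers at a time. These two facts give injectivity of the coding and continuity in both
directions.

For surjectivity, a red edge g with the same source as the first edge of y can be prepended to the
code of y: condition (g) of an `l`-diagram carries g down along y, and condition (e) completes the
red edges to a preimage of y (`exists_sigma_eq`). Hence every finite admissible word is realised,
and a diagonal argument realises infinite ones.

Rigidity of the canonical resolution comes from one property of (E', C'), that distinct blue edges
have distinct ranges. It survives two resolution steps (`resolution₂_blue_inj`) and makes each R(f)
a singleton. -/

/-- A map between spaces of sequences is continuous if each initial segment of the image is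
determined by an initial segment of the argument. -/
theorem continuous_cylinderTopology {A B : ℕ → Type u} {S : Set (∀ n, A n)} {T : Set (∀ n, B n)}
    (φ : S → T)
    (h : ∀ N, ∃ M, ∀ x y : S, (∀ i ≤ M, x.1 i = y.1 i) → ∀ i ≤ N, (φ x).1 i = (φ y).1 i) :
    @Continuous S T (cylinderTopology S) (cylinderTopology T) φ := by
  let _ := cylinderTopology S
  refine continuous_generateFrom_iff.2 ?_
  rintro _ ⟨a, N, rfl⟩
  obtain ⟨M, hM⟩ := h N
  refine isOpen_iff_forall_mem_open.2 fun x hx => ?_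
  -- The cylinder of length M around x is an open neighbourhood on which the first N entries of the
  -- image do not change.
  refine ⟨{y : S | ∀ i ≤ M, y.1 i = x.1 i}, fun y hy i hi => ?_,
    TopologicalSpace.isOpen_generateFrom_of_mem ⟨x.1, M, rfl⟩, fun _ _ => rfl⟩
  exact (hM y x hy i hi).trans (hx i hi)

/-- Dependent choice along a sequence of types. -/
theorem exists_sequence {A : ℕ → Type u} (Q : ∀ n, A n → Prop) (T : ∀ n, A n → A (n + 1) → Prop)
    (a : A 0) (ha : Q 0 a) (h : ∀ n a, Q n a → ∃ b, Q (n + 1) b ∧ T n a b) :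
    ∃ f : ∀ n, A n, f 0 = a ∧ ∀ n, Q n (f n) ∧ T n (f n) (f (n + 1)) := by
  choose g hg hT using h
  let F : ∀ n, {a : A n // Q n a} := fun n =>
    Nat.rec ⟨a, ha⟩ (fun n b => ⟨g n b.1 b.2, hg n b.1 b.2⟩) n
  exact ⟨fun n => (F n).1, rfl, fun n => ⟨(F n).2, hT n _ _⟩⟩

/-! ### Coding of paths in an `l`-diagram -/

namespace LDiagram

variable {F : LDiagram.{u}}

theorem r_eq_of_mem_Rof {n : ℕ} (hn : Even n) {f : F.E n} (hf : f ∉ F.blue n) {g : F.E (n + 1)}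
    (hg : g ∈ F.Rof f) : F.r g = F.s f := by
  refine F.D_range (n + 1) (F.s f) (F.Rof f) ?_ g hg
  rw [(F.cond_b n hn (F.s f)).2]
  exact Or.inr ⟨f, hf, rfl, rfl⟩

theorem Rof_nonempty {n : ℕ} (hn : Even n) {f : F.E n} (hf : f ∉ F.blue n) :
    (F.Rof f).Nonempty := by
  refine F.D_nonempty (n + 1) (F.s f) (F.Rof f) ?_
  rw [(F.cond_b n hn (F.s f)).2]
  exact Or.inr ⟨f, hf, rfl, rfl⟩

theorem exists_blue (n : ℕ) (v : F.V n) : ∃ e, F.r e = v ∧ e ∈ F.blue n := by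
  by_cases hn : Even n
  · exact (F.cond_a n hn v).1
  · cases n with
    | zero => exact absurd Even.zero hn
    | succ m =>
      rw [Nat.even_add_one, not_not] at hn
      exact (F.cond_b m hn v).1

/-- The blue half of a romb starting at an even layer, from its red half. -/
theorem exists_blue_evenRomb {n : ℕ} (hn : Even n) {f₀ : F.E n} {f₁ : F.E (n + 1)}
    (h₀ : f₀ ∉ F.blue n) (h₁ : f₁ ∈ F.Rof f₀) :
    ∃ e₀ e₁, e₀ ∈ F.blue n ∧ e₁ ∈ F.blue (n + 1) ∧ F.r e₁ = F.s e₀ ∧ F.EvenRomb e₀ e₁ f₀ f₁ := by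
  have hmem : F.s f₁ ∈ ⋃ f ∈ {f | F.r f = F.r f₀ ∧ f ∉ F.blue n}, F.s '' F.Rof f :=
    Set.mem_biUnion (show f₀ ∈ _ from ⟨rfl, h₀⟩) ⟨f₁, h₁, rfl⟩
  rw [← F.cond_e n hn (F.r f₀)] at hmem
  obtain ⟨e₀, ⟨hr, he₀⟩, e₁, ⟨hr₁, he₁⟩, hs⟩ := Set.mem_iUnion₂.1 hmem
  exact ⟨e₀, e₁, he₀, he₁, hr₁, h₀, F.cond_b_red n hn f₀ h₀ f₁ h₁, hr.symm,
    (r_eq_of_mem_Rof hn h₀ h₁).symm, hs.symm, h₁⟩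

theorem PathSpace.blue (x : F.PathSpace) (n : ℕ) : x.1 n ∈ F.blue n :=
  (show x.1 ∈ F.bluePaths from x.2) n |>.1

theorem PathSpace.r_succ (x : F.PathSpace) (n : ℕ) : F.r (x.1 (n + 1)) = F.s (x.1 n) :=
  (show x.1 ∈ F.bluePaths from x.2) n |>.2

/-- The sequence of red edges linking `x` to `σ(x)`. -/
noncomputable def redPath (x : F.PathSpace) : ∀ n, F.E n := (F.sigma_spec x).choose

theorem redPath_evenRomb (x : F.PathSpace) {n : ℕ} (hn : Even n) :
    F.EvenRomb (x.1 n) (x.1 (n + 1)) (redPath x n) (redPath x (n + 1)) :=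
  ((F.sigma_spec x).choose_spec n hn).1

theorem redPath_oddRomb (x : F.PathSpace) {n : ℕ} (hn : Even n) :
    F.OddRomb ((F.sigma x).1 (n + 1)) ((F.sigma x).1 (n + 2)) (redPath x (n + 1))
      (redPath x (n + 2)) :=
  ((F.sigma_spec x).choose_spec n hn).2

theorem eq_redPath (x : F.PathSpace) {n : ℕ} (hn : Even n) {f₀ : F.E n} {f₁ : F.E (n + 1)}
    (h : F.EvenRomb (x.1 n) (x.1 (n + 1)) f₀ f₁) :
    f₀ = redPath x n ∧ f₁ = redPath x (n + 1) :=
  Prod.ext_iff.1 ((existsUnique_evenRomb hn _ _ (x.blue n) (x.blue (n + 1)) (x.r_succ n)).unique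
    (y₁ := (f₀, f₁)) (y₂ := (redPath x n, redPath x (n + 1))) h (redPath_evenRomb x hn))

theorem redPath_congr {x y : F.PathSpace} {n : ℕ} (hn : Even n) (h₀ : x.1 n = y.1 n)
    (h₁ : x.1 (n + 1) = y.1 (n + 1)) :
    redPath x n = redPath y n ∧ redPath x (n + 1) = redPath y (n + 1) := by
  refine eq_redPath y hn ?_
  rw [← h₀, ← h₁]
  exact redPath_evenRomb x hn

theorem s_redPath_succ (x : F.PathSpace) {n : ℕ} (hn : Even n) :
    F.s (redPath x (n + 1)) = F.r (redPath x (n + 2)) := by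
  rw [(redPath_evenRomb x hn).2.2.2.2.1, (redPath_evenRomb x (hn.add even_two)).2.2.1]
  exact (x.r_succ (n + 1)).symm

/-- The blue half of a romb starting at an odd layer is determined by its red half. -/
theorem oddRomb_unique {n : ℕ} (hn : Even n) {f₀ : F.E (n + 1)} {f₁ : F.E (n + 2)}
    (h₀ : f₀ ∉ F.blue (n + 1)) (h₁ : f₁ ∉ F.blue (n + 2)) (hs : F.s f₀ = F.r f₁)
    {a a' : F.E (n + 1)} {b b' : F.E (n + 2)} (h : F.OddRomb a b f₀ f₁)
    (h' : F.OddRomb a' b' f₀ f₁) : a = a' ∧ b = b' :=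
  Prod.ext_iff.1 ((F.cond_f n hn _ f₀ f₁ h₀ h₁ rfl hs).unique (y₁ := (a, b)) (y₂ := (a', b')) h h')

/-- The edges of `σ(x)` below layer `2n` depend on the edges of `x` below layer `2(n+1)` only. -/
theorem sigma_congr {x y : F.PathSpace} {n : ℕ} (h : ∀ i < 2 * (n + 1), x.1 i = y.1 i) :
    ∀ i < 2 * n, (F.sigma x).1 i = (F.sigma y).1 i := by
  have key : ∀ m, Even m → m < 2 * n →
      (F.sigma x).1 (m + 1) = (F.sigma y).1 (m + 1) ∧
        (F.sigma x).1 (m + 2) = (F.sigma y).1 (m + 2) := by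
    intro m hm hlt
    have hm2 : Even (m + 2) := hm.add even_two
    -- The odd romb at layers m+1, m+2 involves red edges fixed by x in layers m, …, m+3. As m is
    -- even and m < 2n, in fact m + 2 ≤ 2n.
    have hlt3 : m + 3 < 2 * (n + 1) := by
      obtain ⟨k, rfl⟩ := hm
      omega
    have h0 := redPath_congr hm (h m (by omega)) (h (m + 1) (by omega))
    have h2 := redPath_congr hm2 (h (m + 2) (by omega)) (h (m + 3) (by omega))
    have hy := redPath_oddRomb y hm
    rw [← h0.2, ← h2.1] at hy
    exact oddRomb_unique hm (redPath_evenRomb x hm).2.1 (redPath_evenRomb x hm2).1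
      (s_redPath_succ x hm) (redPath_oddRomb x hm) hy
  intro i hi
  cases i with
  | zero =>
    -- The initial edge lies in no odd romb; it is the only blue edge whose source is the range of
    -- the next edge.
    refine F.cond_d_inj 0 Even.zero (PathSpace.blue _ 0) (PathSpace.blue _ 0) ?_
    rw [← PathSpace.r_succ, ← PathSpace.r_succ, (key 0 Even.zero hi).1]
  | succ m =>
    by_cases hm : Even m
    · exact (key m hm (by omega)).1
    · cases m with
      | zero => exact absurd Even.zero hm
      | succ k =>
        rw [Nat.even_add_one, not_not] at hm
        exact (key k hm (by omega)).2

theorem iterate_sigma_congr (k : ℕ) : ∀ {x y : F.PathSpace} {n : ℕ},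
    (∀ i < 2 * (n + k), x.1 i = y.1 i) →
      ∀ i < 2 * n, (F.sigma^[k] x).1 i = (F.sigma^[k] y).1 i := by
  induction k with
  | zero => exact fun h => h
  | succ k ih =>
    intro x y n h
    rw [Function.iterate_succ_apply, Function.iterate_succ_apply]
    exact ih (sigma_congr h)

/-- The sequence of the first red edges attached to `x`, `σ(x)`, `σ²(x)`, … -/
noncomputable def code (x : F.PathSpace) (n : ℕ) : F.E 0 := redPath (F.sigma^[n] x) 0

/-- Definitional, because `F.sigma^[n + 1] x` unfolds to `F.sigma^[n] (F.sigma x)`. This is the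
intertwining relation. -/
theorem code_sigma (x : F.PathSpace) (n : ℕ) : code (F.sigma x) n = code x (n + 1) := rfl

theorem code_red (x : F.PathSpace) (n : ℕ) : code x n ∉ F.blue 0 :=
  (redPath_evenRomb _ Even.zero).1

theorem code_congr {x y : F.PathSpace} {n : ℕ} (h : ∀ i < 2 * (n + 1), x.1 i = y.1 i) :
    ∀ i ≤ n, code x i = code y i := by
  intro i hi
  have := iterate_sigma_congr i (x := x) (y := y) (n := 1) fun j hj => h j (by omega)
  exact (redPath_congr Even.zero (this 0 (by omega)) (this 1 (by omega))).1

/-- The link is the initial edge of σⁿ⁺¹(x). The even romb of σⁿ⁺¹(x) gives its range. Its source is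
the range of the next edge, which by the odd romb is r(f₁) = s(f₀), where f is the red sequence of
σⁿ(x). -/
theorem exists_blue_code (x : F.PathSpace) (n : ℕ) :
    ∃ e ∈ F.blue 0, F.r e = F.r (code x (n + 1)) ∧ F.s e = F.s (code x n) := by
  refine ⟨(F.sigma^[n + 1] x).1 0, PathSpace.blue _ 0,
    (redPath_evenRomb _ Even.zero).2.2.1.symm, ?_⟩
  have h1 := (redPath_oddRomb (F.sigma^[n] x) Even.zero).2.2.1
  have h2 := (redPath_evenRomb (F.sigma^[n] x) Even.zero).2.2.2.1
  rw [← Function.iterate_succ_apply' F.sigma n x] at h1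
  rw [← PathSpace.r_succ]
  exact h1.trans h2.symm

theorem sigma_eq_of_sigmaRel {x y : F.PathSpace} (h : F.SigmaRel x y) : F.sigma x = y :=
  (existsUnique_sigmaRel x).unique (F.sigma_spec x) h

/-- Every compatible red edge in layer `0` comes from a preimage of `y`. -/
theorem exists_sigma_eq (y : F.PathSpace) {g : F.E 0} (hg : g ∉ F.blue 0)
    (hs : F.s g = F.s (y.1 0)) : ∃ x, F.sigma x = y ∧ code x 0 = g := by
  -- Condition (g) yields red edges in pairs, in layers n+1 and n+2 for n even, whereas the sequence
  -- is built one edge at a time. The invariant therefore carries, at odd layers, the existence of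
  -- the second member of the pair.
  obtain ⟨f, rfl, hf⟩ := exists_sequence (A := F.E)
    (fun n a => a ∉ F.blue n ∧ (Even n → F.s a = F.r (y.1 (n + 1))) ∧
      (¬ Even n → ∃ b : F.E (n + 1), b ∉ F.blue (n + 1) ∧ F.s a = F.r b ∧
        F.s b = F.s (y.1 (n + 1))))
    (fun n a b => (Even n → b ∈ F.Rof a ∧ F.r b = F.r (y.1 (n + 1))) ∧
      (¬ Even n → F.s a = F.r b ∧ F.s b = F.s (y.1 (n + 1))))
    g ⟨hg, fun _ => hs.trans (y.r_succ 0).symm, fun h => absurd Even.zero h⟩ (by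
      rintro n a ⟨ha, h0, h1⟩
      by_cases hn : Even n
      · obtain ⟨⟨p, q⟩, ⟨hp, hq, hpR, hpr, hpq, hqs⟩, -⟩ := F.cond_g n hn _ a (y.1 (n + 1))
          (y.1 (n + 2)) ha (h0 hn) (y.blue _) (y.blue _) rfl (y.r_succ _).symm
        have hn1 : ¬ Even (n + 1) := by rwa [Nat.even_add_one, not_not]
        exact ⟨p, ⟨hp, fun h => absurd h hn1, fun _ => ⟨q, hq, hpq, hqs⟩⟩, fun _ => ⟨hpR, hpr⟩,
          fun h => absurd hn h⟩
      · obtain ⟨b, hb, hab, hsb⟩ := h1 hn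
        exact ⟨b, ⟨hb, fun _ => hsb.trans (y.r_succ _).symm,
          fun h => absurd (Nat.even_add_one.2 hn) h⟩, fun h => absurd h hn, fun _ => ⟨hab, hsb⟩⟩)
  have hodd : ∀ n, Even n → ¬ Even (n + 1) := fun n hn => by rwa [Nat.even_add_one, not_not]
  obtain ⟨x, hx⟩ := exists_pairs (A := F.E)
    (fun n a b => a ∈ F.blue n ∧ b ∈ F.blue (n + 1) ∧ F.r b = F.s a ∧
      F.EvenRomb a b (f n) (f (n + 1)))
    fun n hn => exists_blue_evenRomb hn (hf n).1.1 ((hf n).2.1 hn).1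
  have hpath : x ∈ F.bluePaths := by
    intro n
    by_cases hn : Even n
    · exact ⟨(hx n hn).1, (hx n hn).2.2.1⟩
    · cases n with
      | zero => exact absurd Even.zero hn
      | succ m =>
        have hm : Even m := by rwa [Nat.even_add_one, not_not] at hn
        refine ⟨(hx m hm).2.1, ?_⟩
        -- Successive even rombs fit together: r(x_{m+2}) = r(f_{m+2}) = s(f_{m+1}) = s(x_{m+1}).
        exact ((hx (m + 2) (hm.add even_two)).2.2.2.2.2.1.symm.trans
          ((hf (m + 1)).2.2 hn).1.symm).trans (hx m hm).2.2.2.2.2.2.2.1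
  refine ⟨⟨x, hpath⟩, sigma_eq_of_sigmaRel ⟨f, fun n hn => ⟨(hx n hn).2.2.2, ?_⟩⟩,
    (eq_redPath ⟨x, hpath⟩ Even.zero (hx 0 Even.zero).2.2.2).1.symm⟩
  exact ⟨y.blue _, y.blue _, ((hf n).2.1 hn).2.symm, (y.r_succ _).symm,
    ((hf (n + 1)).2.2 (hodd n hn)).2.symm⟩

/-- Every red edge in layer `0` is the first letter of a code. -/
theorem exists_code_zero {g : F.E 0} (hg : g ∉ F.blue 0) : ∃ x : F.PathSpace, code x 0 = g := by
  obtain ⟨g₁, hg₁⟩ := Rof_nonempty Even.zero hg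
  obtain ⟨e₀, e₁, h₀, h₁, hr, hromb⟩ := exists_blue_evenRomb Even.zero hg hg₁
  obtain ⟨z, rfl, hz⟩ := exists_sequence (A := fun n => F.E (n + 1))
    (fun n a => a ∈ F.blue (n + 1)) (fun n a b => F.r b = F.s a) e₁ h₁ (fun n a _ => by
      obtain ⟨b, hb, hb'⟩ := exists_blue (n + 2) (F.s a)
      exact ⟨b, hb', hb⟩)
  let x : ∀ n, F.E n := fun n => match n with
    | 0 => e₀
    | n + 1 => z n
  have hx : x ∈ F.bluePaths := by
    intro n
    cases n with
    | zero => exact ⟨h₀, hr⟩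
    | succ m => exact hz m
  exact ⟨⟨x, hx⟩, (eq_redPath ⟨x, hx⟩ Even.zero hromb).1.symm⟩

/-! ### Rigid `l`-diagrams: paths and their codes determine each other -/

/-- Conditions under which a path is determined by its code: in the even layers blue edges are
determined by their range and the sets `R(f)` are singletons; in the even layers other than the
first one, red edges are determined by their range and source. -/
structure Rigid (F : LDiagram.{u}) : Prop where
  blue_inj : ∀ n, Even n → Set.InjOn (F.r (n := n)) (F.blue n)
  Rof_subsingleton : ∀ n, Even n → ∀ f : F.E n, f ∉ F.blue n → (F.Rof f).Subsingleton
  red_ext : ∀ n, Even n → ∀ f g : F.E (n + 2), f ∉ F.blue (n + 2) → g ∉ F.blue (n + 2) →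
    F.r f = F.r g → F.s f = F.s g → f = g

namespace Rigid

variable (hF : F.Rigid)
include hF

/-- The red edge fₙ fixes xₙ through its range and fₙ₊₁ because R(fₙ) is a singleton. Then xₙ₊₁ is
the blue edge with range s(xₙ) and source s(fₙ₊₁). -/
theorem eq_of_redPath_eq {x y : F.PathSpace} {n : ℕ} (hn : Even n)
    (h : redPath x n = redPath y n) : x.1 n = y.1 n ∧ x.1 (n + 1) = y.1 (n + 1) := by
  have hx := redPath_evenRomb x hn
  have hy := redPath_evenRomb y hn
  have h0 : x.1 n = y.1 n := hF.blue_inj n hn (x.blue n) (y.blue n) <| by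
    rw [← hx.2.2.1, ← hy.2.2.1, h]
  have h1 : redPath x (n + 1) = redPath y (n + 1) :=
    hF.Rof_subsingleton n hn _ hx.1 hx.2.2.2.2.2 (by rw [h]; exact hy.2.2.2.2.2)
  refine ⟨h0, F.cond_c_blue_inj n hn (F.s (x.1 n)) ⟨x.r_succ n, x.blue _⟩
    ⟨(y.r_succ n).trans (congrArg F.s h0.symm), y.blue _⟩ ?_⟩
  rw [← hx.2.2.2.2.1, ← hy.2.2.2.2.1, h1]

/-- The next red edge, f_{2j+2}, has range s(x_{2j+1}), known from the previous step, and source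
s(σ(x)_{2j+2}), known from σ(x). -/
theorem eq_of_sigma_eq {x y : F.PathSpace} {n : ℕ} (h : code x 0 = code y 0)
    (hσ : ∀ i < 2 * n, (F.sigma x).1 i = (F.sigma y).1 i) :
    ∀ i < 2 * (n + 1), x.1 i = y.1 i := by
  have key : ∀ j ≤ n, x.1 (2 * j) = y.1 (2 * j) ∧ x.1 (2 * j + 1) = y.1 (2 * j + 1) := by
    intro j
    induction j with
    | zero => exact fun _ => hF.eq_of_redPath_eq Even.zero h
    | succ j ih =>
      intro hj
      have h2j : Even (2 * j) := even_two_mul j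
      obtain ⟨h0, h1⟩ := ih (by omega)
      refine hF.eq_of_redPath_eq (n := 2 * j + 2) (h2j.add even_two) ?_
      have hx := redPath_evenRomb x (h2j.add even_two)
      have hy := redPath_evenRomb y (h2j.add even_two)
      refine hF.red_ext _ h2j _ _ hx.1 hy.1 ?_ ?_
      · rw [hx.2.2.1, hy.2.2.1]
        exact (x.r_succ _).trans ((congrArg F.s h1).trans (y.r_succ _).symm)
      · rw [← (redPath_oddRomb x h2j).2.2.2.2, ← (redPath_oddRomb y h2j).2.2.2.2]
        -- For j + 1 = n the hypothesis on σ(x) stops at layer 2j+1. Layer 2j+2 still follows, since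
        -- its blue edge is determined by its range s(σ(x)_{2j+1}).
        refine congrArg F.s (hF.blue_inj _ (h2j.add even_two) (PathSpace.blue _ _)
          (PathSpace.blue _ _) ?_)
        exact (PathSpace.r_succ _ _).trans ((congrArg F.s (hσ (2 * j + 1) (by omega))).trans
          (PathSpace.r_succ _ _).symm)
  intro i hi
  obtain ⟨j, rfl | rfl⟩ := Nat.even_or_odd' i
  · exact (key j (by omega)).1
  · exact (key j (by omega)).2

theorem eq_of_code_eq (n : ℕ) : ∀ {x y : F.PathSpace}, (∀ i ≤ n, code x i = code y i) →
    ∀ i < 2 * (n + 1), x.1 i = y.1 i := by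
  induction n with
  | zero =>
    intro x y h
    exact hF.eq_of_sigma_eq (h 0 le_rfl) fun i hi => absurd hi (by omega)
  | succ n ih =>
    intro x y h
    exact hF.eq_of_sigma_eq (h 0 (Nat.zero_le _))
      (ih fun i hi => by rw [code_sigma, code_sigma]; exact h _ (by omega))

theorem code_injective : Function.Injective (code (F := F)) := by
  intro x y h
  refine Subtype.ext (funext fun i => ?_)
  exact hF.eq_of_code_eq i (fun j _ => congrFun h j) i (by omega)

/-- Words are built from right to left: realise the tail by some y, then take the preimage of y
whose first letter is z₀. -/
theorem exists_code_eq_of_le (n : ℕ) : ∀ z : ℕ → F.E 0, (∀ n, z n ∉ F.blue 0) →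
    (∀ n, ∃ e ∈ F.blue 0, F.r e = F.r (z (n + 1)) ∧ F.s e = F.s (z n)) →
    ∃ x : F.PathSpace, ∀ i ≤ n, code x i = z i := by
  induction n with
  | zero =>
    intro z hz _
    obtain ⟨x, hx⟩ := exists_code_zero (hz 0)
    exact ⟨x, fun i hi => by rw [Nat.le_zero.1 hi, hx]⟩
  | succ n ih =>
    intro z hz he
    obtain ⟨y, hy⟩ := ih (fun n => z (n + 1)) (fun n => hz _) (fun n => he _)
    obtain ⟨e, hb, hr, hs⟩ := he 0
    -- The first edge of y and the linking blue edge both have range r(z₁), so they coincide; hence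
    -- z₀ has the source required for prepending.
    have hy0 : y.1 0 = e := by
      refine hF.blue_inj 0 Even.zero (y.blue 0) hb ?_
      rw [hr, ← (redPath_evenRomb y Even.zero).2.2.1]
      exact congrArg F.r (hy 0 (Nat.zero_le _))
    obtain ⟨x, hx, hx0⟩ := exists_sigma_eq y (hz 0) (by rw [hy0, hs])
    refine ⟨x, fun i hi => ?_⟩
    cases i with
    | zero => exact hx0
    | succ i =>
      rw [← code_sigma, hx]
      exact hy i (by omega)

/-- A compatible sequence of red edges in layer `0` is the code of a path. -/
theorem exists_code_eq (z : ℕ → F.E 0) (hz : ∀ n, z n ∉ F.blue 0)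
    (he : ∀ n, ∃ e ∈ F.blue 0, F.r e = F.r (z (n + 1)) ∧ F.s e = F.s (z n)) :
    ∃ x : F.PathSpace, ∀ n, code x n = z n := by
  choose w hw using fun n => hF.exists_code_eq_of_le n z hz he
  have hww : ∀ {m n}, m ≤ n → ∀ i < 2 * (m + 1), (w m).1 i = (w n).1 i := fun {m n} hmn =>
    hF.eq_of_code_eq m fun i hi => by rw [hw m i hi, hw n i (hi.trans hmn)]
  -- The path `w n` realises the letters up to n, and those letters fix its layers below 2(n+1), so
  -- the approximations stabilise and their diagonal is a path.
  have hx : (fun i => (w i).1 i) ∈ F.bluePaths := by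
    intro n
    refine ⟨(w n).blue n, ?_⟩
    have : (w n).1 n = (w (n + 1)).1 n := hww (Nat.le_succ n) n (by omega)
    exact ((w (n + 1)).r_succ n).trans (congrArg F.s this.symm)
  refine ⟨⟨_, hx⟩, fun n => ?_⟩
  rw [← hw n n le_rfl]
  refine code_congr (n := n) (fun i hi => ?_) n le_rfl
  rcases le_total i n with h | h
  · exact hww h i (by omega)
  · exact (hww h i hi).symm

end Rigid

end LDiagram

/-! ### Rigidity of the canonical resolution -/

namespace BipartiteSeparatedGraph

section

variable {G : BipartiteSeparatedGraph.{u}} {b : Set G.E1}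

/-- A vertex v(x₁, x₂) under the red edge f consists of f and a blue edge with range r(f), and there
is only one such blue edge. -/
theorem IsShiftGraph.resBlock_subsingleton (h : G.IsShiftGraph b) (hinj : Set.InjOn G.r b)
    {f : G.E1} (hf : f ∉ b) : (G.resBlock f).Subsingleton := by
  have hfst : ∀ α ∈ G.resBlock f, α.1.1 = G.r f := by
    intro α hα
    have := G.C_range _ _ α.2.2 _ (α.1.2 α.2).2
    rw [← show α.top = f from hα]
    exact this.symm
  intro α hα β hβ
  have hw : α.1 = β.1 := by
    have hαβ : α.1.1 = β.1.1 := (hfst α hα).trans (hfst β hβ).symm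
    have hα' : α.top = β.top := Eq.trans (show α.top = f from hα) (show β.top = f from hβ).symm
    have hr : α.top ∉ b := by rwa [show α.top = f from hα]
    obtain ⟨⟨v, c⟩, Y⟩ := α
    obtain ⟨⟨v', c'⟩, Y'⟩ := β
    obtain rfl : v = v' := hαβ
    refine congrArg (Sigma.mk v) (funext fun Z => Subtype.ext ?_)
    have hα'' : (c Y : G.E1) = c' Y' := hα'
    have hr' : (c Y : G.E1) ∉ b := hr
    by_cases hZ : (c Z : G.E1) ∈ b
    · refine hinj hZ ?_ ((G.C_range _ _ Z.2 _ (c Z).2).trans (G.C_range _ _ Z.2 _ (c' Z).2).symm)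
      by_contra hZ'
      have hE := h.block_red Z.2 Y.2 (c' Z).2 (c Y).2 hZ' hr'
      rw [Subtype.ext hE] at hZ
      exact hr' hZ
    · have h1 := h.block_red Z.2 Y.2 (c Z).2 (c Y).2 hZ hr'
      have h2 := h.block_red Z.2 Y'.2 (c Z).2 (c' Y').2 hZ (hα'' ▸ hr')
      rw [Subtype.ext h1, hα'', ← Subtype.ext h2, Subtype.ext h1]
  exact (h.resolution_red_src β.1).unique ⟨hw, by rwa [show α.top = f from hα]⟩
    ⟨rfl, by rwa [show β.top = f from hβ]⟩

/-- The range of a blue edge β fixes `top β`, as a vertex emits only one blue edge. The source of β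
chooses an element from each X(x) with s(x) = v: for blue x it is `top β`, and for red x the set
X(x) is a singleton. So the source is fixed too. -/
theorem IsShiftGraph.resolution₂_blue_inj (h : G.IsShiftGraph b) (hinj : Set.InjOn G.r b) :
    Set.InjOn G.resolution.resolution.r (G.resolution.resBlue (G.resBlue b)) := by
  intro β hβ β' hβ' hr
  have htop : ResEdge.top β = ResEdge.top β' :=
    (h.good.resolution_src _).unique ⟨hr, hβ⟩ ⟨rfl, hβ'⟩
  have hv : β.1 = β'.1 := by
    have e1 := G.resolution.C_range _ _ β.2.2 _ (β.1.2 β.2).2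
    have e2 := G.resolution.C_range _ _ β'.2.2 _ (β'.1.2 β'.2).2
    have hvv : β.1.1 = β'.1.1 := e1.symm.trans ((congrArg G.resolution.r htop).trans e2)
    have hb : ResEdge.top (show G.ResEdge from ResEdge.top β) ∈ b := hβ
    obtain ⟨⟨v, c⟩, Y⟩ := β
    obtain ⟨⟨v', c'⟩, Y'⟩ := β'
    obtain rfl : v = v' := hvv
    refine congrArg (Sigma.mk v) (funext fun Z => Subtype.ext ?_)
    have hcc : (c Y).1 = (c' Y').1 := htop
    obtain ⟨Z, x, hx, rfl⟩ := Z
    have hcx : ResEdge.top (G := G) (c ⟨_, x, hx, rfl⟩).1 = x :=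
      (c ⟨_, x, hx, rfl⟩).2
    have hcx' : ResEdge.top (G := G) (c' ⟨_, x, hx, rfl⟩).1 = x :=
      (c' ⟨_, x, hx, rfl⟩).2
    by_cases hxb : x ∈ b
    -- Only one blue edge has source v, so X(x) is the only blue block at v, and both `Y` and `Y'`
    -- are equal to it.
    · have key : ∀ W : G.resolution.C v, ∀ α ∈ W.1, ResEdge.top (show G.ResEdge from α) ∈ b →
          W = ⟨_, x, hx, rfl⟩ := by
        rintro ⟨_, y, hy, rfl⟩ α hα hαb
        have : y = x := (h.good.1 v).unique
          ⟨hy, by rwa [← show ResEdge.top (show G.ResEdge from α) = y from hα]⟩ ⟨hx, hxb⟩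
        subst this
        rfl
      have hY := key Y _ (c Y).2 hb
      have hY' := key Y' _ (c' Y').2 (by rw [← hcc]; exact hb)
      rw [← hY, hcc, hY', hY]
    · exact h.resBlock_subsingleton hinj hxb hcx hcx'
  exact (h.good.resolution.resolution_src β'.1).unique ⟨hv, hβ⟩ ⟨rfl, hβ'⟩

/-- Red blocks at a vertex may be numerous here, so the source alone does not suffice. The range
supplies `top β`, whose own `top` is the x that labels the block X(x) of β. -/
theorem IsShiftGraph.resolution₂_red_ext (h : G.IsShiftGraph b)
    {β β' : G.resolution.resolution.E1} (hβ : β ∉ G.resolution.resBlue (G.resBlue b))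
    (hβ' : β' ∉ G.resolution.resBlue (G.resBlue b))
    (hr : G.resolution.resolution.r β = G.resolution.resolution.r β')
    (hs : G.resolution.resolution.s β = G.resolution.resolution.s β') : β = β' := by
  have htop : ResEdge.top β = ResEdge.top β' :=
    (h.resolution_red_src _).unique ⟨hr, hβ⟩ ⟨rfl, hβ'⟩
  obtain ⟨w, ⟨_, x, hx, rfl⟩⟩ := β
  obtain ⟨w', ⟨_, x', hx', rfl⟩⟩ := β'
  obtain rfl : w = w' := hs
  have h1 : ResEdge.top (G := G) (w.2 ⟨_, x, hx, rfl⟩).1 = x :=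
    (w.2 ⟨_, x, hx, rfl⟩).2
  have h2 : ResEdge.top (G := G) (w.2 ⟨_, x', hx', rfl⟩).1 = x' :=
    (w.2 ⟨_, x', hx', rfl⟩).2
  have : x = x' := h1.symm.trans ((congrArg (ResEdge.top (G := G)) htop).trans h2)
  subst this
  rfl

theorem IsShiftGraph.step_blue_inj (h : G.IsShiftGraph b) (hinj : Set.InjOn G.r b) :
    ∀ n, Even n → Set.InjOn (G.stepResolution n).r (G.stepBlue b n) := by
  intro n hn
  obtain ⟨k, rfl⟩ := hn
  induction k with
  | zero => exact hinj
  | succ k ih =>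
    have : k + 1 + (k + 1) = (k + k) + 2 := by ring
    rw [this]
    exact (h.step _ ⟨k, rfl⟩).resolution₂_blue_inj ih

/-- If distinct blue edges of `G` have distinct ranges, then paths in the canonical resolution of
`G` are determined by their codes. -/
theorem IsShiftGraph.rigid_lDiagram (h : G.IsShiftGraph b) (hinj : Set.InjOn G.r b) :
    (G.lDiagram b h).Rigid where
  blue_inj := h.step_blue_inj hinj
  Rof_subsingleton n hn _ hf :=
    (h.step n hn).resBlock_subsingleton (h.step_blue_inj hinj n hn) hf
  red_ext n hn _ _ hf hg hr hs := (h.step n hn).resolution₂_red_ext hf hg hr hs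

end

end BipartiteSeparatedGraph

/-! ### The conjugacy -/

theorem proposition5p11 {V E : Type u} [Finite V] [Finite E] [Nonempty V]
    (Γ : DirectedGraph V E) (hsinks : Γ.NoSinks) (hsources : Γ.NoSources) :
    TopologicallyConjugate
      ((Γ.separatedGraph hsources).lDiagram (Γ.separatedBlue hsources)
        (Γ.isShiftGraph hsinks hsources)).sigma
      Γ.shift := by
  set F := (Γ.separatedGraph hsources).lDiagram (Γ.separatedBlue hsources)
    (Γ.isShiftGraph hsinks hsources)
  have hF : F.Rigid := by
    refine BipartiteSeparatedGraph.IsShiftGraph.rigid_lDiagram _ ?_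
    rintro _ ⟨i, rfl⟩ _ ⟨j, rfl⟩ hij
    exact congrArg Sum.inl hij
  have hred : ∀ g : F.E 0, g ∉ F.blue 0 → ∃ e : E, g = (Sum.inr e : V ⊕ E) := by
    rintro (i | e) hg
    · exact absurd ⟨i, rfl⟩ hg
    · exact ⟨e, rfl⟩
  choose φ hφ using fun (x : F.PathSpace) n => hred _ (LDiagram.code_red x n)
  have hshift : ∀ x n, Γ.s (φ x n) = Γ.r (φ x (n + 1)) := by
    intro x n
    obtain ⟨_, ⟨i, rfl⟩, hr, hs⟩ := LDiagram.exists_blue_code x n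
    rw [hφ] at hr hs
    exact Eq.trans (Eq.symm hs) hr
  let h : F.PathSpace → Γ.ShiftSpace := fun x => ⟨φ x, hshift x⟩
  have hval : ∀ x n, LDiagram.code x n = (Sum.inr ((h x).1 n) : V ⊕ E) := hφ
  have hcode : ∀ {x y : F.PathSpace} {n}, LDiagram.code x n = LDiagram.code y n ↔
      (h x).1 n = (h y).1 n := by
    intro x y n
    rw [hval, hval]
    exact Sum.inr.inj_iff
  have hinj : Function.Injective h := by
    intro x y hxy
    exact hF.code_injective (funext fun n => hcode.2 (by rw [hxy]))
  have hsurj : Function.Surjective h := by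
    rintro ⟨z, hz⟩
    obtain ⟨x, hx⟩ := hF.exists_code_eq (fun n => (Sum.inr (z n) : V ⊕ E))
      (fun n => by rintro ⟨i, hi⟩; exact Sum.inl_ne_inr hi)
      -- The link between two letters is the blue edge at their common vertex i = s(zₙ) = r(zₙ₊₁).
      (fun n => ⟨(Sum.inl (Γ.s (z n)) : V ⊕ E), ⟨_, rfl⟩, hz n, rfl⟩)
    exact ⟨x, Subtype.ext (funext fun n => Sum.inr_injective ((hval x n).symm.trans (hx n)))⟩
  let e : F.PathSpace ≃ Γ.ShiftSpace := Equiv.ofBijective h ⟨hinj, hsurj⟩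
  refine ⟨⟨e, ?_, ?_⟩, ?_⟩
  · refine continuous_cylinderTopology (A := F.E) (B := fun _ => E) _ fun N => ⟨2 * (N + 1), ?_⟩
    intro x y hxy i hi
    exact hcode.1 (LDiagram.code_congr (n := N) (fun j hj => hxy j (by omega)) i hi)
  · refine continuous_cylinderTopology (A := fun _ => E) (B := F.E) _ fun N => ⟨N, ?_⟩
    intro x y hxy i hi
    refine hF.eq_of_code_eq N (fun j hj => hcode.2 ?_) i (by omega)
    exact ((congrArg (fun z => z.1 j) (e.apply_symm_apply x)).trans (hxy j hj)).trans
      (congrArg (fun z => z.1 j) (e.apply_symm_apply y)).symm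
  · funext x
    refine Subtype.ext (funext fun n => Sum.inr_injective (α := V) ?_)
    exact (hval (F.sigma x) n).symm.trans (hval x (n + 1))
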